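/- Let $p$ be a prime and let $R$ be an $F$-finite regular integral domain of characteristic $p$ (that is, $R$ is a regular Noetherian domain whose Frobenius endomorphism is finite). For an ideal $\mathfrak{a}$ of $R$ and a power $q=p^e$ ($e\ge 0$), let $\mathfrak{a}^{[q]}=\langle f^q : f\in\mathfrak{a}\rangle$, and let $\mathfrak{a}^{[1/q]}$ be the smallest ideal $\mathfrak{c}$ such that $\mathfrak{a}\subseteq \mathfrak{c}^{[q]}$. For an integer $k\ge 0$ with base $p$ expansion $k=k_0+k_1p+\cdots+k_rp^r$, put \[ \mathfrak{a}^{[k]}=\mathfrak{a}^{k_0}\,(\mathfrak{a}^{k_1})^{[p]}\cdots(\mathfrak{a}^{k_r})^{[p^r]},\qquad \mathfrak{a}^{[k/q]}=\big(\mathfrak{a}^{[k]}\big)^{[1/q]}, \] and for real $t>0$ let the real Frobenius power $\mathfrak{a}^{[t]}$ be the union of the ideals $\mathfrak{a}^{[k/q]}$ over all $k\ge 0$ and all powers $q$ of $p$ with $k/q\ge t$ (equivalently, the union along any sequence of such fractions decreasing to $t$). For real $c>0$ let the test ideal be \[ \tau(\mathfrak{a}^c)=\bigcup_{e\ge 0}\big(\mathfrak{a}^{\lceil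 c p^e\rceil}\big)^{[1/p^e]}. \] Proposition. Let $m\ge 1$ be an integer, let $\mathfrak{a}$ be an ideal of $R$ that can be generated by $m$ elements, and let $t$ be a real number with $0<t<1$. Then \[ \tau\big(\mathfrak{a}^{\,t+\frac{m-1}{p-1}}\big)\subseteq \mathfrak{a}^{[t]}\subseteq \tau(\mathfrak{a}^t). \] -/

import Mathlib

namespace FrobeniusPowers

/-- The bracket power `𝔞^[q] = ⟨f ^ q : f ∈ 𝔞⟩` (used for `q` a power of the characteristic). -/
def bracketPow {R : Type*} [CommRing R] (q : ℕ) (a : Ideal R) : Ideal R :=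
  Ideal.span ((fun f : R => f ^ q) '' (a : Set R))

/-- The integral Frobenius power
`𝔞^[k] = 𝔞^{k₀} · (𝔞^{k₁})^[p] ⋯ (𝔞^{kᵣ})^[p^r]`, where `k = k₀ + k₁ p + ⋯ + kᵣ p^r` is the
base `p` expansion of `k`; the `i`-th digit is `kᵢ = (k / p ^ i) % p`. -/
def intFrobPow {R : Type*} [CommRing R] (p k : ℕ) (a : Ideal R) : Ideal R :=
  ∏ i ∈ Finset.range (Nat.digits p k).length, bracketPow (p ^ i) (a ^ (k / p ^ i % p))

/-- The Frobenius root `𝔞^[1/q]`: the smallest ideal `𝔠` with `𝔞 ⊆ 𝔠^[q]`. -/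
def frobRoot {R : Type*} [CommRing R] (q : ℕ) (a : Ideal R) : Ideal R :=
  sInf {c : Ideal R | a ≤ bracketPow q c}

/-- The `p`-rational Frobenius power `𝔞^[k/p^e] = (𝔞^[k])^[1/p^e]`. -/
def pRatFrobPow {R : Type*} [CommRing R] (p k e : ℕ) (a : Ideal R) : Ideal R :=
  frobRoot (p ^ e) (intFrobPow p k a)

/-- The real Frobenius power `𝔞^[t]`, for `t ≥ 0`: the union of the `p`-rational Frobenius powers
`𝔞^[k/p^e]` over the `p`-rational approximations `k/p^e ≥ t` of `t` from above.  These ideals grow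
as `k/p^e` decreases, so the union is also the union (and the eventual value) along any sequence
of `p`-rational numbers decreasing to `t`. -/
noncomputable def realFrobPow {R : Type*} [CommRing R] (p : ℕ) (a : Ideal R) (t : ℝ) : Ideal R :=
  ⨆ (k : ℕ) (e : ℕ) (_ : t ≤ (k : ℝ) / (p : ℝ) ^ e), pRatFrobPow p k e a

/-- The test ideal `τ(𝔞^c) = ⋃ₑ (𝔞^⌈c p^e⌉)^[1/p^e]`, for `c ≥ 0`.  (The union is increasing.) -/
noncomputable def testIdeal {R : Type*} [CommRing R] (p : ℕ) (a : Ideal R) (c : ℝ) : Ideal R :=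
  ⨆ e : ℕ, frobRoot (p ^ e) (a ^ ⌈c * (p : ℝ) ^ e⌉₊)

end FrobeniusPowers

/-! Right inclusion: `𝔟^[q] ⊆ 𝔟^q` gives `𝔞^[k] ⊆ 𝔞^k`, and `k/p^e ≥ t` means `k ≥ ⌈t p^e⌉`, so the
two unions compare term by term.

Left inclusion: pigeonhole on monomials in the `m` generators, one base `p` digit at a time from the
top, gives `𝔞^(k + (m-1)(p^(n-1)-1)) ⊆ 𝔞^[k]` for `k < p^n` (`span_range_pow_le_intFrobPow`). For `k
= ⌈t p^E⌉` the shift `(m-1)/(p-1)` pays for the excess, since `p^E/(p-1) ≥ p^(E-1)`; `t < 1` gives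
`k < p^E` once `E` is large.

Passing to large `E` needs the chain defining `τ` to increase, hence that `x^p ∈ I^[p]` implies `x ∈
I`. This is the only use of regularity. It is local, and over a regular local ring Frobenius is
free: a system of parameters generating the maximal ideal is a regular sequence, so are its `p`-th
powers, and a finite module on which such parameters are weakly regular is free. -/

section

open IsLocalRing RingTheory.Sequence

/-! ### Weakly regular sequences: powers, and a freeness criterion -/

section RegularSequences

variable {R : Type*} [CommRing R]

/-- Reducing the sequence modulo `r` keeps it exact on the left because `r` is regular on `M₃`. -/
lemma isWeaklyRegular_of_exact {M₁ M₂ M₃ : Type*} [AddCommGroup M₁] [Module R M₁]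
    [AddCommGroup M₂] [Module R M₂] [AddCommGroup M₃] [Module R M₃] (rs : List R)
    (f : M₁ →ₗ[R] M₂) (g : M₂ →ₗ[R] M₃) (hf : Function.Injective f) (hfg : Function.Exact f g)
    (hg : Function.Surjective g) (h₁ : IsWeaklyRegular M₁ rs) (h₃ : IsWeaklyRegular M₃ rs) :
    IsWeaklyRegular M₂ rs := by
  induction rs generalizing M₁ M₂ M₃ with
  | nil => exact .nil R M₂
  | cons r rs ih =>
    rw [isWeaklyRegular_cons_iff] at h₁ h₃ ⊢
    refine ⟨isSMulRegular_of_range_eq_ker hf hfg.linearMap_ker_eq.symm h₁.1 h₃.1,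
      ih (QuotSMulTop.map r f) (QuotSMulTop.map r g) ?_ (QuotSMulTop.map_exact r hfg hg)
        (QuotSMulTop.map_surjective r hg) h₁.2 h₃.2⟩
    have h0 : Function.Exact (0 : M₁ →ₗ[R] M₁) f := by
      rw [LinearMap.exact_iff, LinearMap.range_zero, LinearMap.ker_eq_bot.mpr hf]
    have := QuotSMulTop.map_first_exact_on_four_term_exact_of_isSMulRegular_last h0 hfg h₃.1
    rw [LinearMap.exact_iff, map_zero, LinearMap.range_zero] at this
    exact LinearMap.ker_eq_bot.mp this

open Pointwise in
lemma isWeaklyRegular_quotSMulTop_pow {M : Type*} [AddCommGroup M] [Module R M] {r : R}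
    {rs : List R} (hr : IsSMulRegular M r) (h : IsWeaklyRegular (QuotSMulTop r M) rs) (n : ℕ) :
    IsWeaklyRegular (QuotSMulTop (r ^ n) M) rs := by
  induction n with
  | zero =>
    have : Subsingleton (QuotSMulTop (r ^ 0) M) := by
      rw [Submodule.Quotient.subsingleton_iff]; simp
    exact ⟨fun i _ ↦ Function.injective_of_subsingleton _⟩
  | succ n ih =>
    -- The sequence is `0 → M/rⁿM → M/rⁿ⁺¹M → M/rM → 0`, whose first map is multiplication by `r`.
    let f : QuotSMulTop (r ^ n) M →ₗ[R] QuotSMulTop (r ^ (n + 1)) M :=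
      Submodule.mapQ _ _ (LinearMap.lsmul R M r) (by
        rintro _ ⟨y, -, rfl⟩
        exact ⟨y, trivial, by simp [pow_succ, mul_smul]⟩)
    let g : QuotSMulTop (r ^ (n + 1)) M →ₗ[R] QuotSMulTop r M :=
      Submodule.mapQ _ _ LinearMap.id (by
        rintro _ ⟨y, -, rfl⟩
        exact ⟨r ^ n • y, trivial, by simp [pow_succ, mul_smul]⟩)
    refine isWeaklyRegular_of_exact rs f g ?_ ?_ ?_ ih h
    · rw [← LinearMap.ker_eq_bot, LinearMap.ker_eq_bot']
      intro x
      obtain ⟨x, rfl⟩ := Submodule.Quotient.mk_surjective _ x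
      intro hx
      have hx' : r • x ∈ r ^ (n + 1) • (⊤ : Submodule R M) :=
        (Submodule.Quotient.mk_eq_zero _).mp hx
      obtain ⟨y, -, hy⟩ := hx'
      refine (Submodule.Quotient.mk_eq_zero _).mpr ⟨y, trivial, hr ?_⟩
      simpa [pow_succ', mul_smul] using hy
    · intro x
      obtain ⟨x, rfl⟩ := Submodule.Quotient.mk_surjective _ x
      constructor
      · intro hx
        have hx' : x ∈ r • (⊤ : Submodule R M) := (Submodule.Quotient.mk_eq_zero _).mp hx
        obtain ⟨y, -, hy⟩ := hx'
        exact ⟨Submodule.Quotient.mk y, congrArg Submodule.Quotient.mk hy⟩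
      · rintro ⟨y, hy⟩
        obtain ⟨y, rfl⟩ := Submodule.Quotient.mk_surjective _ y
        rw [← hy]
        exact (Submodule.Quotient.mk_eq_zero _).mpr ⟨y, trivial, rfl⟩
    · intro x
      obtain ⟨x, rfl⟩ := Submodule.Quotient.mk_surjective _ x
      exact ⟨Submodule.Quotient.mk x, rfl⟩

lemma RingTheory.Sequence.IsWeaklyRegular.map_pow {M : Type*} [AddCommGroup M] [Module R M]
    {rs : List R} (h : IsWeaklyRegular M rs) (n : ℕ) :
    IsWeaklyRegular M (rs.map (· ^ n)) := by
  induction rs generalizing M with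
  | nil => exact .nil R M
  | cons r rs ih =>
    rw [isWeaklyRegular_cons_iff] at h
    rw [List.map_cons, isWeaklyRegular_cons_iff]
    exact ⟨h.1.pow n, isWeaklyRegular_quotSMulTop_pow h.1 (ih h.2) n⟩

lemma map_mk_ofList_cons (r : R) (rs : List R) :
    (Ideal.ofList (r :: rs)).map (Ideal.Quotient.mk (Ideal.span {r})) =
      Ideal.ofList (rs.map (Ideal.Quotient.mk (Ideal.span {r}))) := by
  rw [Ideal.ofList_cons, Ideal.map_sup, Ideal.map_quotient_self, bot_sup_eq, Ideal.map_ofList]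

lemma maximalIdeal_quotient_span_singleton [IsLocalRing R] {r : R} {rs : List R}
    (hm : maximalIdeal R = Ideal.ofList (r :: rs)) [IsLocalRing (R ⧸ Ideal.span {r})] :
    maximalIdeal (R ⧸ Ideal.span {r}) =
      Ideal.ofList (rs.map (Ideal.Quotient.mk (Ideal.span {r}))) := by
  rw [← map_mk_ofList_cons, ← hm]
  exact (IsLocalRing.map_maximalIdeal_of_surjective _ Ideal.Quotient.mk_surjective).symm

lemma isLocalRing_quotient_span_singleton [IsLocalRing R] {r : R} (hr : r ∈ maximalIdeal R) :
    IsLocalRing (R ⧸ Ideal.span {r}) := by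
  have : Nontrivial (R ⧸ Ideal.span {r}) := by
    rw [Ideal.Quotient.nontrivial_iff, Ne, Ideal.span_singleton_eq_top]
    exact hr
  exact .of_surjective' _ Ideal.Quotient.mk_surjective

/-- Regularity of `r` on `M` lets freeness lift from `M/rM` over `R/r`; after killing all generators
of the maximal ideal, the base is a field. -/
lemma free_of_isWeaklyRegular {R : Type*} [CommRing R] [IsLocalRing R] [IsNoetherianRing R]
    {M : Type*} [AddCommGroup M] [Module R M] [Module.Finite R M] (rs : List R)
    (hm : maximalIdeal R = Ideal.ofList rs) (h : IsWeaklyRegular M rs) : Module.Free R M := by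
  generalize hn : rs.length = n
  induction n generalizing R M rs with
  | zero =>
    rw [List.length_eq_zero_iff] at hn
    subst hn
    let := (IsLocalRing.isField_iff_maximalIdeal_eq.mpr
      (hm.trans Ideal.ofList_nil)).toField
    infer_instance
  | succ n ih =>
    obtain ⟨r, rs, rfl⟩ := List.exists_cons_of_length_eq_add_one hn
    have hr : r ∈ maximalIdeal R := hm ▸ Ideal.subset_span (by simp)
    have := isLocalRing_quotient_span_singleton hr
    rw [isWeaklyRegular_cons_iff'] at h
    have : Module.FinitePresentation R M := Module.finitePresentation_of_finite R M
    have : Module.Finite (R ⧸ Ideal.span {r}) (QuotSMulTop r M) :=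
      Module.Finite.of_restrictScalars_finite R _ _
    rw [← Module.free_quotSMulTop_iff_free R M (x := r)
      (by rwa [IsLocalRing.jacobson_eq_maximalIdeal _ bot_ne_top]) h.1]
    exact ih _ (maximalIdeal_quotient_span_singleton hm) h.2 (by simpa using hn)

end RegularSequences

/-! ### Regular local rings: domains, with parameters forming a regular sequence -/

section RegularLocalRings

lemma exists_isPrime_le_ringKrullDim_quotient {R : Type*} [CommRing R] (n : ℕ)
    (h : n ≤ ringKrullDim R) : ∃ P : Ideal R, P.IsPrime ∧ n ≤ ringKrullDim (R ⧸ P) := by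
  obtain ⟨l, hl⟩ := Order.le_krullDim_iff.mp h
  refine ⟨l.head.asIdeal, l.head.isPrime, ?_⟩
  rw [ringKrullDim_quotient]
  refine Order.le_krullDim_iff.mpr
    ⟨⟨l.length, fun i ↦ ⟨l i, l.head_le i⟩, fun i ↦ l.step i⟩, hl⟩

lemma ringKrullDim_le_length {R : Type*} [CommRing R] [IsLocalRing R] [IsNoetherianRing R]
    (rs : List R) (hm : maximalIdeal R = Ideal.ofList rs) : ringKrullDim R ≤ rs.length := by
  refine (ringKrullDim_le_spanFinrank_maximalIdeal R).trans ?_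
  classical
  have hs : {r | r ∈ rs} = (rs.toFinset : Set R) := by ext; simp
  rw [hm, Ideal.ofList, hs]
  exact_mod_cast (Submodule.spanFinrank_span_le_ncard_of_finite rs.toFinset.finite_toSet).trans
    ((Set.ncard_coe_finset _).trans_le (List.toFinset_card_le rs))

lemma le_ringKrullDim_quotient_span_singleton {R : Type*} [CommRing R] [IsLocalRing R]
    [IsNoetherianRing R] {r : R} (hr : r ∈ maximalIdeal R) {n : ℕ}
    (h : (n + 1 : ℕ) ≤ ringKrullDim R) : n ≤ ringKrullDim (R ⧸ Ideal.span {r}) := by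
  have h1 := ringKrullDim_le_ringKrullDim_quotient_add_card (R := R) {r}
    (by simpa [IsLocalRing.ringJacobson_eq_maximalIdeal] using hr)
  rw [Finset.coe_singleton, Finset.card_singleton] at h1
  have := h.trans h1
  push_cast at this
  exact ENat.WithBot.add_le_add_one_right_iff.mp this

/-- By induction `R/r` is a domain of dimension at most `n`. A prime `P` with `dim R/P ≥ n + 1`
cannot contain `r`, yet must lie in `(r)`; hence `P = rP`, and Nakayama gives `P = 0`. -/
theorem isDomain_of_length_le_ringKrullDim {R : Type*} [CommRing R] [IsLocalRing R]
    [IsNoetherianRing R] (rs : List R) (hm : maximalIdeal R = Ideal.ofList rs)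
    (h : rs.length ≤ ringKrullDim R) : IsDomain R := by
  generalize hn : rs.length = n at h
  induction n generalizing R rs with
  | zero =>
    rw [List.length_eq_zero_iff] at hn
    subst hn
    exact (IsLocalRing.isField_iff_maximalIdeal_eq.mpr (hm.trans Ideal.ofList_nil)).isDomain
  | succ n ih =>
    obtain ⟨r, rs, rfl⟩ := List.exists_cons_of_length_eq_add_one hn
    have hr : r ∈ maximalIdeal R := hm ▸ Ideal.subset_span (by simp)
    have := isLocalRing_quotient_span_singleton hr
    have hm' := maximalIdeal_quotient_span_singleton hm
    have hn' : (rs.map (Ideal.Quotient.mk (Ideal.span {r}))).length = n := by simpa using hn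
    have hle := ringKrullDim_le_length _ hm'
    rw [hn'] at hle
    have hdom := ih _ hm' hn' (le_ringKrullDim_quotient_span_singleton hr h)
    obtain ⟨P, hP, hdim⟩ := exists_isPrime_le_ringKrullDim_quotient (n + 1) h
    have hrP : r ∉ P := by
      intro hrP
      have := (hdim.trans (ringKrullDim_le_of_surjective
        (Ideal.Quotient.factor ((Ideal.span_singleton_le_iff_mem P).mpr hrP))
        (Ideal.Quotient.factor_surjective _))).trans hle
      exact absurd (Nat.cast_le (α := WithBot ℕ∞).mp this) (by omega)
    -- An element `y ∈ P` outside `(r)` would be a nonzerodivisor on the domain `R/r`, so `dim R/(r,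
    -- y) ≤ n - 1`. But `R/(r, y)` surjects onto `R/(P + (r))`, of dimension at least `n`.
    have hPr : P ≤ Ideal.span {r} := by
      intro y hy
      by_contra hyr
      have : IsLocalRing (R ⧸ P) := .of_surjective' _ Ideal.Quotient.mk_surjective
      have hrm : Ideal.Quotient.mk P r ∈ maximalIdeal (R ⧸ P) := by
        rw [← IsLocalRing.map_maximalIdeal_of_surjective _ Ideal.Quotient.mk_surjective]
        exact Ideal.mem_map_of_mem _ hr
      have h1 := le_ringKrullDim_quotient_span_singleton hrm hdim
      have hy0 : Ideal.Quotient.mk (Ideal.span {r}) y ≠ 0 := by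
        rwa [Ne, Ideal.Quotient.eq_zero_iff_mem]
      have h2 := ringKrullDim_quotient_succ_le_of_nonZeroDivisor
        (mem_nonZeroDivisors_of_ne_zero hy0)
      let φ : R →+* (R ⧸ P) ⧸ Ideal.span {Ideal.Quotient.mk P r} :=
        (Ideal.Quotient.mk _).comp (Ideal.Quotient.mk P)
      have hφ : Function.Surjective φ :=
        Ideal.Quotient.mk_surjective.comp Ideal.Quotient.mk_surjective
      have hφr : ∀ a ∈ Ideal.span {r}, φ a = 0 := by
        intro a ha
        obtain ⟨b, rfl⟩ := Ideal.mem_span_singleton.mp ha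
        rw [map_mul]
        have : φ r = 0 := Ideal.Quotient.eq_zero_iff_mem.mpr (Ideal.mem_span_singleton_self _)
        rw [this, zero_mul]
      let ψ := Ideal.Quotient.lift (Ideal.span {r}) φ hφr
      have hψ : ∀ a ∈ Ideal.span {Ideal.Quotient.mk (Ideal.span {r}) y}, ψ a = 0 := by
        intro a ha
        obtain ⟨b, rfl⟩ := Ideal.mem_span_singleton.mp ha
        have : ψ (Ideal.Quotient.mk (Ideal.span {r}) y) = 0 := by
          simp [ψ, φ, Ideal.Quotient.eq_zero_iff_mem.mpr hy]
        rw [map_mul, this, zero_mul]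
      have h3 := ringKrullDim_le_of_surjective (Ideal.Quotient.lift _ ψ hψ)
        (Ideal.Quotient.lift_surjective_of_surjective _ hψ
          (Ideal.Quotient.lift_surjective_of_surjective _ hφr hφ))
      have h4 : ((n + 1 : ℕ) : WithBot ℕ∞) ≤ n := by
        push_cast
        exact (add_le_add_left (h1.trans h3) 1).trans (h2.trans hle)
      exact absurd (Nat.cast_le (α := WithBot ℕ∞).mp h4) (by omega)
    have hP0 : P = ⊥ := by
      refine Submodule.eq_bot_of_le_smul_of_le_jacobson_bot (Ideal.span {r}) P
        (IsNoetherian.noetherian P) ?_ ?_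
      · intro y hy
        obtain ⟨b, rfl⟩ := Ideal.mem_span_singleton.mp (hPr hy)
        exact Submodule.smul_mem_smul (Ideal.mem_span_singleton_self r)
          ((hP.mem_or_mem hy).resolve_left hrP)
      · rw [Ideal.span_singleton_le_iff_mem, IsLocalRing.jacobson_eq_maximalIdeal _ bot_ne_top]
        exact hr
    exact IsDomain.of_bot_isPrime R (hbp := hP0 ▸ hP)

theorem isWeaklyRegular_of_length_le_ringKrullDim {R : Type*} [CommRing R] [IsLocalRing R]
    [IsNoetherianRing R] (rs : List R) (hm : maximalIdeal R = Ideal.ofList rs)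
    (h : rs.length ≤ ringKrullDim R) : IsWeaklyRegular R rs := by
  generalize hn : rs.length = n at h
  induction n generalizing R rs with
  | zero =>
    rw [List.length_eq_zero_iff] at hn
    subst hn
    exact .nil R R
  | succ n ih =>
    have := isDomain_of_length_le_ringKrullDim rs hm (hn ▸ h)
    obtain ⟨r, rs, rfl⟩ := List.exists_cons_of_length_eq_add_one hn
    have hr : r ∈ maximalIdeal R := hm ▸ Ideal.subset_span (by simp)
    have := isLocalRing_quotient_span_singleton hr
    have hm' := maximalIdeal_quotient_span_singleton hm
    have hn' : (rs.map (Ideal.Quotient.mk (Ideal.span {r}))).length = n := by simpa using hn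
    have hle := ringKrullDim_le_length _ hm'
    have hreg := ih _ hm' hn' (le_ringKrullDim_quotient_span_singleton hr h)
    rw [isWeaklyRegular_cons_iff]
    constructor
    -- In a domain only `r = 0` could fail, and then `R ≅ R/r` would have dimension at most `n`.
    · refine IsSMulRegular.of_right_eq_zero_of_smul fun x hx ↦ ?_
      refine (mul_eq_zero.mp hx).resolve_left ?_
      rintro rfl
      have h1 := h.trans ((ringKrullDim_eq_of_ringEquiv (RingEquiv.quotientBot R)).ge)
      rw [hn', Ideal.span_singleton_zero] at hle
      exact absurd (Nat.cast_le (α := WithBot ℕ∞).mp (h1.trans hle)) (by omega)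
    · have h1 := (isWeaklyRegular_map_algebraMap_iff (M := R ⧸ Ideal.span {r})
        (R ⧸ Ideal.span {r}) rs).mp hreg
      refine (LinearEquiv.isWeaklyRegular_congr (Submodule.quotEquivOfEq _ _ ?_) rs).mp h1
      rw [← Submodule.ideal_span_singleton_smul, smul_eq_mul, Ideal.mul_top]

end RegularLocalRings

/-! ### Ideals are contracted along Frobenius -/

section Frobenius

/-- `B` is free and nonzero over `A`, hence faithfully flat. -/
lemma comap_map_eq_of_finite_of_isWeaklyRegular {A B : Type*} [CommRing A] [IsLocalRing A]
    [IsNoetherianRing A] [CommRing B] [Nontrivial B] (f : A →+* B) (hf : f.Finite) (rs : List A)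
    (hm : maximalIdeal A = Ideal.ofList rs) (h : IsWeaklyRegular B (rs.map f)) (I : Ideal A) :
    (I.map f).comap f = I := by
  algebraize [f]
  have : Module.Finite A B := hf
  have h' : IsWeaklyRegular B rs := (isWeaklyRegular_map_algebraMap_iff (M := B) B rs).mp h
  have := free_of_isWeaklyRegular rs hm h'
  exact Ideal.comap_map_eq_self_of_faithfullyFlat (B := B) I

theorem IsRegularLocalRing.comap_map_frobenius {A : Type*} [CommRing A] [IsRegularLocalRing A]
    (p : ℕ) [ExpChar A p] (hF : (frobenius A p).Finite) (I : Ideal A) :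
    (I.map (frobenius A p)).comap (frobenius A p) = I := by
  obtain ⟨s, hs, hs'⟩ := (IsNoetherian.noetherian
    (maximalIdeal A)).exists_span_finset_card_eq_spanFinrank
  have hm : maximalIdeal A = Ideal.ofList s.toList := by
    rw [← hs', Ideal.ofList]
    simp [Ideal.span]
  have hreg := isWeaklyRegular_of_length_le_ringKrullDim s.toList hm
    (by rw [Finset.length_toList, hs, IsRegularLocalRing.spanFinrank_maximalIdeal])
  exact comap_map_eq_of_finite_of_isWeaklyRegular _ hF _ hm (hreg.map_pow p) I

lemma RingHom.finite_iff_exists_fin {A B : Type*} [CommRing A] [CommRing B] (f : A →+* B) :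
    f.Finite ↔ ∃ (n : ℕ) (s : Fin n → B), ∀ x, ∃ c : Fin n → A, ∑ i, f (c i) * s i = x := by
  algebraize [f]
  refine Iff.trans (b := Module.Finite A B) Iff.rfl ⟨fun h ↦ ?_, fun ⟨n, s, hs⟩ ↦ ?_⟩
  · obtain ⟨n, s, hs⟩ := Module.Finite.exists_fin (R := A) (M := B)
    refine ⟨n, s, fun x ↦ ?_⟩
    exact Submodule.mem_span_range_iff_exists_fun A |>.mp (hs ▸ Submodule.mem_top : x ∈ _)
  · refine .of_surjective (Fintype.linearCombination A s) fun x ↦ ?_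
    obtain ⟨c, hc⟩ := hs x
    exact ⟨c, hc⟩

lemma finite_frobenius_of_isLocalization {R : Type*} [CommRing R] (M : Submonoid R) (S : Type*)
    [CommRing S] [Algebra R S] [IsLocalization M S] (p : ℕ) [ExpChar R p] [ExpChar S p]
    (hF : (frobenius R p).Finite) : (frobenius S p).Finite := by
  rw [RingHom.finite_iff_exists_fin] at hF ⊢
  obtain ⟨n, s, hs⟩ := hF
  refine ⟨n, fun i ↦ algebraMap R S (s i), fun x ↦ ?_⟩
  obtain ⟨a, u, rfl⟩ := IsLocalization.exists_mk'_eq M x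
  -- Writing `a/u = a u^(p-1) / u^p` makes the denominator a `p`-th power, which is absorbed into
  -- the coefficients `c i / u`.
  obtain ⟨c, hc⟩ := hs (a * (u : R) ^ (p - 1))
  refine ⟨fun i ↦ IsLocalization.mk' S (c i) u, ?_⟩
  have hu : IsUnit (algebraMap R S ((u : R) ^ p)) := by
    rw [map_pow]
    exact (IsLocalization.map_units S u).pow p
  refine hu.mul_left_cancel ?_
  have hp : (u : R) ^ p = u * (u : R) ^ (p - 1) := by
    rw [← pow_succ', Nat.sub_add_cancel (expChar_pos R p)]
  have h1 : algebraMap R S ((u : R) ^ p) * IsLocalization.mk' S a u =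
      algebraMap R S (a * (u : R) ^ (p - 1)) := by
    rw [hp, map_mul, map_mul, mul_right_comm, IsLocalization.mk'_spec']
  rw [h1, ← hc, map_sum, Finset.mul_sum]
  refine Finset.sum_congr rfl fun i _ ↦ ?_
  rw [frobenius_def, frobenius_def, map_mul, ← mul_assoc, map_pow, ← mul_pow,
    IsLocalization.mk'_spec', map_pow]

theorem IsRegularRing.comap_map_frobenius {R : Type*} [CommRing R] [IsDomain R] [IsRegularRing R]
    (p : ℕ) [Fact p.Prime] [CharP R p] (hF : (frobenius R p).Finite) (I : Ideal R) :
    (I.map (frobenius R p)).comap (frobenius R p) = I := by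
  refine le_antisymm (fun x hx ↦ Ideal.mem_of_localization_maximal fun P hP ↦ ?_)
    Ideal.le_comap_map
  have : CharP (Localization.AtPrime P) p := charP_of_injective_algebraMap
    (IsLocalization.injective _ P.primeCompl_le_nonZeroDivisors) p
  rw [← IsRegularLocalRing.comap_map_frobenius p
    (finite_frobenius_of_isLocalization P.primeCompl _ p hF) (I.map _), Ideal.mem_comap,
    Ideal.map_map, ← RingHom.frobenius_comm, ← Ideal.map_map, ← RingHom.map_frobenius]
  exact Ideal.mem_map_of_mem _ hx

end Frobenius

end

namespace FrobeniusPowers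

/-! ### Integral Frobenius powers inside ordinary powers -/

section

variable {R : Type*} [CommRing R]

lemma pow_mem_bracketPow (q : ℕ) {a : Ideal R} {x : R} (hx : x ∈ a) : x ^ q ∈ bracketPow q a :=
  Ideal.subset_span ⟨x, hx, rfl⟩

lemma bracketPow_le_pow (q : ℕ) (a : Ideal R) : bracketPow q a ≤ a ^ q := by
  rw [bracketPow, Ideal.span_le]
  rintro _ ⟨x, hx, rfl⟩
  exact Ideal.pow_mem_pow hx q

lemma bracketPow_one_ideal (q : ℕ) : bracketPow q (1 : Ideal R) = 1 := by
  rw [Ideal.one_eq_top, Ideal.eq_top_iff_one]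
  simpa using pow_mem_bracketPow q (Submodule.mem_top : (1 : R) ∈ (⊤ : Ideal R))

lemma frobRoot_mono (q : ℕ) {a b : Ideal R} (h : a ≤ b) : frobRoot q a ≤ frobRoot q b :=
  sInf_le_sInf fun _ hc ↦ h.trans hc

lemma prod_bracketPow_le_pow (p n k : ℕ) (a : Ideal R) :
    ∏ i ∈ Finset.range n, bracketPow (p ^ i) (a ^ (k / p ^ i % p)) ≤ a ^ (k % p ^ n) := by
  induction n with
  | zero => simp [Nat.mod_one]
  | succ n ih =>
    rw [Finset.prod_range_succ, Nat.mod_pow_succ, pow_add, mul_comm (p ^ n), pow_mul]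
    exact Ideal.mul_mono ih (bracketPow_le_pow _ _)

/-- Padding with leading zero digits only adds unit factors; a uniform number of digits is what the
induction on digits requires. -/
lemma intFrobPow_eq_prod_range (p k n : ℕ) (hp : 1 < p) (hk : k < p ^ n) (a : Ideal R) :
    intFrobPow p k a = ∏ i ∈ Finset.range n, bracketPow (p ^ i) (a ^ (k / p ^ i % p)) := by
  refine Finset.prod_subset (Finset.range_subset_range.mpr
    ((Nat.digits_length_le_iff hp k).mpr hk)) fun i _ hi ↦ ?_
  have : k < p ^ i := (Nat.lt_base_pow_length_digits hp).trans_le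
    (Nat.pow_le_pow_right hp.le (by simpa using hi))
  rw [Nat.div_eq_of_lt this, Nat.zero_mod, pow_zero, bracketPow_one_ideal]

lemma intFrobPow_le_pow (p k : ℕ) (hp : 1 < p) (a : Ideal R) : intFrobPow p k a ≤ a ^ k := by
  refine (prod_bracketPow_le_pow p _ k a).trans_eq ?_
  rw [Nat.mod_eq_of_lt (Nat.lt_base_pow_length_digits hp)]

theorem realFrobPow_le_testIdeal (p : ℕ) (hp : 1 < p) (a : Ideal R) (t : ℝ) :
    realFrobPow p a t ≤ testIdeal p a t := by
  refine iSup_le fun k ↦ iSup_le fun e ↦ iSup_le fun h ↦ ?_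
  refine le_trans ?_ (le_iSup _ e)
  refine frobRoot_mono _ ((intFrobPow_le_pow p k hp a).trans (Ideal.pow_le_pow_right ?_))
  rw [Nat.ceil_le]
  rwa [le_div_iff₀ (by positivity)] at h

end

/-! ### Ordinary powers inside integral Frobenius powers -/

section Monomials

variable {R : Type*} [CommRing R] {m : ℕ} (f : Fin m → R)

lemma prod_pow_mem_pow (v : Fin m → ℕ) :
    ∏ j, f j ^ v j ∈ Ideal.span (Set.range f) ^ ∑ j, v j := by
  rw [← Finset.prod_pow_eq_pow_sum]
  exact Ideal.prod_mem_prod fun j _ ↦ Ideal.pow_mem_pow (Ideal.subset_span (Set.mem_range_self j)) _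

lemma span_range_pow_le (n : ℕ) :
    Ideal.span (Set.range f) ^ n ≤
      Ideal.span {x | ∃ v : Fin m → ℕ, ∑ j, v j = n ∧ x = ∏ j, f j ^ v j} := by
  induction n with
  | zero =>
    refine le_top.trans (top_le_iff.mpr ((Ideal.eq_top_iff_one _).mpr (Ideal.subset_span ?_)))
    exact ⟨0, by simp⟩
  | succ n ih =>
    rw [pow_succ]
    refine (Ideal.mul_mono_left ih).trans ?_
    rw [Ideal.span_mul_span', Ideal.span_le]
    rintro _ ⟨_, ⟨v, hv, rfl⟩, _, ⟨i, rfl⟩, rfl⟩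
    refine Ideal.subset_span ⟨v + Pi.single i 1, ?_, ?_⟩
    · simp [Finset.sum_add_distrib, hv]
    · simp only [Pi.add_apply, pow_add, Finset.prod_mul_distrib]
      simp [Pi.single_apply, pow_ite]

lemma exists_le_sum_eq {ι : Type*} [Fintype ι] (w : ι → ℕ) (d : ℕ) (h : d ≤ ∑ j, w j) :
    ∃ v : ι → ℕ, v ≤ w ∧ ∑ j, v j = d := by
  classical
  induction d with
  | zero => exact ⟨0, fun _ ↦ Nat.zero_le _, by simp⟩
  | succ d ih =>
    obtain ⟨v, hvw, hv⟩ := ih (by omega)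
    obtain ⟨i, -, hi⟩ := Finset.exists_lt_of_sum_lt (s := Finset.univ) (f := v) (g := w) (by omega)
    refine ⟨v + Pi.single i 1, fun j ↦ ?_, by simp [Finset.sum_add_distrib, hv]⟩
    by_cases hj : j = i
    · subst hj; simpa using hi
    · simpa [hj] using hvw j

/-- The top digit `d` is split off as the `p^n`-th power of a monomial of degree `d`; what remains
still has enough degree for the lower digits. -/
lemma monomial_mem_prod_bracketPow (p k n : ℕ) (hp : 1 < p) (hm : 1 ≤ m) (u : Fin m → ℕ)
    (hu : k % p ^ n + (m - 1) * (p ^ (n - 1) - 1) ≤ ∑ j, u j) :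
    ∏ j, f j ^ u j ∈ ∏ i ∈ Finset.range n,
      bracketPow (p ^ i) (Ideal.span (Set.range f) ^ (k / p ^ i % p)) := by
  induction n generalizing u with
  | zero => simp
  | succ n ih =>
    obtain ⟨q, hq⟩ : ∃ q, p ^ n = q + 1 := Nat.exists_eq_add_of_le' (Nat.one_le_pow _ _ hp.le)
    obtain ⟨m', rfl⟩ : ∃ m', m = m' + 1 := Nat.exists_eq_add_of_le' hm
    set d := k / p ^ n % p with hd
    rw [Nat.mod_pow_succ, ← hd, Nat.add_sub_cancel, Nat.add_sub_cancel] at hu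
    -- Each of the `m` remainders modulo `p^n` is at most `p^n - 1`. If the quotients summed to at
    -- most `d - 1`, the degree would be at most `p^n d + (m-1)(p^n-1) - 1`, one short of the
    -- hypothesis.
    have hw : d ≤ ∑ j, u j / p ^ n := by
      have h1 : ∑ j, u j ≤ ∑ j, (p ^ n * (u j / p ^ n) + q) := Finset.sum_le_sum fun j _ ↦ by
        have := Nat.div_add_mod (u j) (p ^ n)
        have := Nat.mod_lt (u j) (y := p ^ n) (by omega)
        omega
      rw [Finset.sum_add_distrib, ← Finset.mul_sum] at h1
      simp only [Finset.sum_const, Finset.card_univ, Fintype.card_fin, smul_eq_mul] at h1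
      rw [hq] at h1 hu ⊢
      simp only [Nat.add_sub_cancel] at hu
      by_contra! hlt
      have h2 := Nat.mul_le_mul_left (q + 1) (Nat.succ_le_of_lt hlt)
      rw [Nat.succ_eq_add_one] at h2
      generalize ∑ j, u j / (q + 1) = S at h1 h2
      generalize k % (q + 1) = r at hu
      nlinarith [Nat.zero_le r]
    obtain ⟨v, hv, hvd⟩ := exists_le_sum_eq _ d hw
    have hvu : ∀ j, p ^ n * v j ≤ u j := fun j ↦
      (Nat.mul_le_mul_left _ (hv j)).trans (Nat.mul_div_le _ _)
    have hsplit : ∏ j, f j ^ u j =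
        (∏ j, f j ^ (u j - p ^ n * v j)) * (∏ j, f j ^ v j) ^ p ^ n := by
      rw [← Finset.prod_pow, ← Finset.prod_mul_distrib]
      refine Finset.prod_congr rfl fun j _ ↦ ?_
      rw [← pow_mul, ← pow_add, mul_comm (v j), Nat.sub_add_cancel (hvu j)]
    rw [hsplit, Finset.prod_range_succ]
    refine Ideal.mul_mem_mul (ih _ ?_) (pow_mem_bracketPow _ (by rw [← hd, ← hvd]; exact prod_pow_mem_pow f v))
    have h2 : ∑ j, (u j - p ^ n * v j) + p ^ n * d = ∑ j, u j := by
      rw [← hvd, Finset.mul_sum, ← Finset.sum_add_distrib]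
      exact Finset.sum_congr rfl fun j _ ↦ Nat.sub_add_cancel (hvu j)
    have h3 : m' * (p ^ (n - 1) - 1) ≤ m' * (p ^ n - 1) :=
      Nat.mul_le_mul_left _ (Nat.sub_le_sub_right
        (Nat.pow_le_pow_right hp.le (Nat.sub_le n 1)) 1)
    simp only [Nat.add_sub_cancel]
    omega

theorem span_range_pow_le_intFrobPow (p k n : ℕ) (hp : 1 < p) (hm : 1 ≤ m) (hk : k < p ^ n) :
    Ideal.span (Set.range f) ^ (k + (m - 1) * (p ^ (n - 1) - 1)) ≤
      intFrobPow p k (Ideal.span (Set.range f)) := by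
  refine (span_range_pow_le f _).trans (Ideal.span_le.mpr ?_)
  rintro _ ⟨v, hv, rfl⟩
  rw [intFrobPow_eq_prod_range p k n hp hk]
  exact monomial_mem_prod_bracketPow f p k n hp hm v (by rw [hv, Nat.mod_eq_of_lt hk])

end Monomials

/-! ### Monotonicity of the test ideal chain and the left inclusion -/

section TestIdeals

variable {R : Type*} [CommRing R] (p : ℕ) [Fact p.Prime] [CharP R p]

lemma bracketPow_eq_map_iterateFrobenius (e : ℕ) (a : Ideal R) :
    bracketPow (p ^ e) a = a.map (iterateFrobenius R p e) := rfl

lemma mem_bracketPow_of_pow_mem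
    (hF : ∀ I : Ideal R, (I.map (frobenius R p)).comap (frobenius R p) = I)
    (c : Ideal R) (e n : ℕ) {x : R} (hx : x ^ p ^ n ∈ bracketPow (p ^ (e + n)) c) :
    x ∈ bracketPow (p ^ e) c := by
  induction n generalizing x with
  | zero => simpa using hx
  | succ n ih =>
    refine ih ?_
    rw [← hF (bracketPow (p ^ (e + n)) c), Ideal.mem_comap, bracketPow_eq_map_iterateFrobenius,
      Ideal.map_map, frobenius_def, ← pow_mul, ← pow_succ]
    convert hx using 1
    rw [bracketPow_eq_map_iterateFrobenius, ← add_assoc]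
    congr 1
    ext x
    simp [iterateFrobenius_def, frobenius_def, ← pow_mul, ← pow_succ]

/-- Every competitor `I` for the root at level `e + n` is one at level `e`: if `x` lies in the
smaller power then `x^(p^n)` lies in the larger one, and the Frobenius powers cancel. So the infima
compare without knowing that they are attained. -/
lemma frobRoot_pow_ceil_le
    (hF : ∀ I : Ideal R, (I.map (frobenius R p)).comap (frobenius R p) = I)
    (a : Ideal R) (c : ℝ) (e n : ℕ) :
    frobRoot (p ^ e) (a ^ ⌈c * (p : ℝ) ^ e⌉₊) ≤
      frobRoot (p ^ (e + n)) (a ^ ⌈c * (p : ℝ) ^ (e + n)⌉₊) := by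
  refine sInf_le_sInf fun I hI x hx ↦ mem_bracketPow_of_pow_mem p hF I e n (hI ?_)
  have h := Ideal.pow_mem_pow hx (p ^ n)
  rw [← pow_mul] at h
  refine Ideal.pow_le_pow_right (Nat.ceil_le.mpr ?_) h
  push_cast
  rw [pow_add, ← mul_assoc]
  exact mul_le_mul_of_nonneg_right (Nat.le_ceil _) (by positivity)

theorem testIdeal_le_realFrobPow
    (hF : ∀ I : Ideal R, (I.map (frobenius R p)).comap (frobenius R p) = I)
    {m : ℕ} (hm : 1 ≤ m) (f : Fin m → R) (t : ℝ) (ht0 : 0 < t) (ht1 : t < 1) :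
    testIdeal p (Ideal.span (Set.range f)) (t + ((m : ℝ) - 1) / ((p : ℝ) - 1)) ≤
      realFrobPow p (Ideal.span (Set.range f)) t := by
  have hp : 1 < p := (Fact.out : p.Prime).one_lt
  have hpR : (1 : ℝ) < p := by exact_mod_cast hp
  refine iSup_le fun e ↦ ?_
  -- This makes `(1 - t) p^E ≥ 1`, so that `⌈t p^E⌉ < t p^E + 1 ≤ p^E`. Using `n + 1` below ensures
  -- `E ≥ 1`, so `E - 1` is a genuine predecessor.
  obtain ⟨n, hn⟩ := pow_unbounded_of_one_lt (1 / (1 - t)) hpR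
  refine (frobRoot_pow_ceil_le p hF _ _ e (n + 1)).trans ?_
  set E := e + (n + 1)
  have hE : 1 ≤ (1 - t) * (p : ℝ) ^ E := by
    rw [div_lt_iff₀' (by linarith)] at hn
    refine hn.le.trans (mul_le_mul_of_nonneg_left ?_ (by linarith))
    exact pow_le_pow_right₀ hpR.le (by omega)
  set k := ⌈t * (p : ℝ) ^ E⌉₊
  have hk : k < p ^ E := by
    have : (k : ℝ) < t * (p : ℝ) ^ E + 1 := Nat.ceil_lt_add_one (by positivity)
    have : (k : ℝ) < (p ^ E : ℕ) := by push_cast; linarith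
    exact_mod_cast this
  have htk : t ≤ (k : ℝ) / (p : ℝ) ^ E := by
    rw [le_div_iff₀ (by positivity)]
    exact Nat.le_ceil _
  refine le_trans ?_ (le_iSup_of_le k (le_iSup_of_le E (le_iSup_of_le htk le_rfl)))
  refine frobRoot_mono _ (le_trans (Ideal.pow_le_pow_right ?_)
    (span_range_pow_le_intFrobPow f p k E hp hm hk))
  -- The excess is an integer, so it moves inside the ceiling, leaving `(m-1)(p^(E-1)-1) ≤ (m-1)
  -- p^E/(p-1)`.
  rw [← Nat.ceil_add_natCast (by positivity)]
  refine Nat.ceil_mono ?_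
  rw [add_mul]
  gcongr
  rw [Nat.cast_mul, Nat.cast_sub hm, div_mul_eq_mul_div, mul_div_assoc, Nat.cast_one]
  have hm' : (1 : ℝ) ≤ m := by exact_mod_cast hm
  refine mul_le_mul_of_nonneg_left ?_ (by linarith)
  rw [le_div_iff₀ (by linarith)]
  have hE1 : (p : ℝ) ^ E = p ^ (E - 1) * p := by rw [← pow_succ]; congr 1
  have h1 : ((p ^ (E - 1) - 1 : ℕ) : ℝ) ≤ (p : ℝ) ^ (E - 1) := by
    rw [← Nat.cast_pow]
    exact_mod_cast Nat.sub_le _ _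
  rw [hE1]
  exact mul_le_mul h1 (by linarith) (by linarith) (by positivity)

end TestIdeals

end FrobeniusPowers

theorem mainTheorem12 {R : Type*} [CommRing R] [IsDomain R] [IsRegularRing R]
    (p : ℕ) [Fact p.Prime] [CharP R p]
    (hF : (frobenius R p).Finite)
    (a : Ideal R) (m : ℕ) (hm : 1 ≤ m)
    (ha : ∃ f : Fin m → R, a = Ideal.span (Set.range f))
    (t : ℝ) (ht0 : 0 < t) (ht1 : t < 1) :
    FrobeniusPowers.testIdeal p a (t + ((m : ℝ) - 1) / ((p : ℝ) - 1))
        ≤ FrobeniusPowers.realFrobPow p a t ∧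
      FrobeniusPowers.realFrobPow p a t ≤ FrobeniusPowers.testIdeal p a t := by
  obtain ⟨f, rfl⟩ := ha
  exact ⟨FrobeniusPowers.testIdeal_le_realFrobPow p
      (IsRegularRing.comap_map_frobenius p hF) hm f t ht0 ht1,
    FrobeniusPowers.realFrobPow_le_testIdeal p (Fact.out : p.Prime).one_lt _ t⟩
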